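/- **Loose graphs.** A loose graph $\Gamma=(V,E,\mathbf I)$ consists of a set $V$ of points, a set $E$ of edges and an incidence relation $\mathbf I\subseteq V\times E$ such that every edge is incident with at most two points ($V$, $E$ may be infinite). $\Gamma$ is *connected* if it is nonempty and any two of its elements (points or edges) are joined by a finite chain of elements in which consecutive ones are incident. The *completion* $\overline\Gamma$ is obtained by adding one new point to every edge with exactly one point and two new points to every edge without points (different edges get different new points). Let $U=V\cup V'$ be its point set, $V'$ being the set of new points. Two different points of $U$ are adjacent in $\overline\Gamma$ if some edge contains both. Let $\mathbb P(\Gamma)$ be the complete graph on $U$. We say that $\Gamma$ is of type I if all its edges have two points (that is, $\Gamma$ is a graph); of type II if the complement $\Gamma^c$ of $\Gamma$ in $\mathbb P(\Gamma)$, which consists of the points of $V'$ and of the edges of $\mathbb P(\Gamma)$ not in $\overline\Gamma$, is a graph (every edge of it has both end points in $V'$); and of type III otherwise. **Schemes.** Let $\mathbb F_1[X_i]_{i\in U}$ be the monoid consisting of $0$ and all monomials in the $X_i$. For a commutative monoid $M=\bigcup_{i\ge0}M_i$ with $0$, graded by degree, $\mathrm{Proj}(M)$ is the set of prime ideals of $M$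 (proper subsets $\mathfrak p\ni 0$ with $M\mathfrak p\subseteq\mathfrak p$ and multiplicatively closed complement) not containing the irrelevant ideal $\{0\}\cup\bigcup_{i\ge1}M_i$, with the Zariski topology, whose closed sets are the sets $V(I)=\{\mathfrak p: I\subseteq\mathfrak p\}$, and with the sheaf of monoids whose sections are the functions that are locally fractions, with values in the degree-zero localizations $M_{(\mathfrak p)}$. A subgraph $\Delta$ of the complete graph on $U$ defines the closed subset $C(\Delta)$ of $\mathrm{Proj}(\mathbb F_1[X_i]_{i\in U})$ given by the equations $X_j$ for the points $j$ not in $\Delta$ and $X_jX_l$ for the pairs $j\neq l$ not joined in $\Delta$. If $\Delta$ contains all points of $U$, the corresponding closed subscheme is $\mathrm{Proj}(\mathbb F_1[X_i]_{i\in U}/I_\Delta)$, where $I_\Delta$ is the union of the ideals $(X_jX_l)$ over the pairs $j\ne l$ not joined in $\Delta$. The *loose scheme* $S(\Gamma)$ is * the closed subscheme $\mathrm{Proj}(\mathbb F_1[X_i]_{i\in U}/I_\Gamma)$ if $\Gamma$ is of type I (then $U=V$); * otherwise, if $\Gamma$ is of type II, the open subscheme $\mathrm{Proj}(\mathbb F_1[X_i]_{i\in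 U})\setminus C(\Gamma^c)$; * if $\Gamma$ is of type III, the intersection of the closed subscheme $\mathrm{Proj}(\mathbb F_1[X_i]_{i\in U}/I_{\overline\Gamma})$ with the open complement of $C(K)$, where $K$ is the complete graph on $V'$. **Theorem (Connectedness of loose schemes).** Let $\Gamma$ be a loose graph in which every edge is incident with at least one point, or which consists of a single edge without points. Then the loose scheme $S(\Gamma)$ is connected if and only if $\Gamma$ is connected. The same holds for complements in an arbitrary complete graph: if $\Delta$ is a subgraph of the complete graph on a set $W$, and the loose graph $\Gamma$ which remains after removing the points and edges of $\Delta$ satisfies the above condition on edges, then the open subscheme $\mathrm{Proj}(\mathbb F_1[X_i]_{i\in W})\setminus C(\Delta)$ is connected if and only if $\Gamma$ is connected. (Connected spaces and connected loose graphs are nonempty by convention.) -/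

import Mathlib

open CategoryTheory TopologicalSpace Opposite

universe u v w

noncomputable section

/-! ### Commutative monoids with zero: ideals, quotients, gradings, `Proj` -/

namespace Deitmar

/-- An ideal of a commutative monoid with zero; it contains `0`. -/
structure MIdeal (M : Type u) [CommMonoidWithZero M] where
  carrier : Set M
  zero_mem : (0 : M) ∈ carrier
  mul_mem : ∀ (a : M) {x : M}, x ∈ carrier → a * x ∈ carrier

/-- The ideal generated by a set: `0` and all multiples of the elements of the set. -/
def MIdeal.span {M : Type u} [CommMonoidWithZero M] (s : Set M) : MIdeal M where
  carrier := {x | x = 0 ∨ ∃ y ∈ s, y ∣ x}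
  zero_mem := Or.inl rfl
  mul_mem := by
    rintro a x (rfl | ⟨y, hy, hyx⟩)
    · exact Or.inl (mul_zero a)
    · exact Or.inr ⟨y, hy, hyx.mul_left a⟩

/-- The congruence which identifies all elements of the ideal `I` and nothing else. -/
def MIdeal.con {M : Type u} [CommMonoidWithZero M] (I : MIdeal M) : Con M where
  r a b := a = b ∨ (a ∈ I.carrier ∧ b ∈ I.carrier)
  iseqv :=
    { refl := fun _ => Or.inl rfl
      symm := by
        rintro a b (rfl | ⟨ha, hb⟩)
        · exact Or.inl rfl
        · exact Or.inr ⟨hb, ha⟩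
      trans := by
        rintro a b c (rfl | ⟨ha, hb⟩) (rfl | ⟨hb', hc⟩)
        · exact Or.inl rfl
        · exact Or.inr ⟨hb', hc⟩
        · exact Or.inr ⟨ha, hb⟩
        · exact Or.inr ⟨ha, hc⟩ }
  mul' := by
    rintro a b c d (rfl | ⟨ha, hb⟩) (rfl | ⟨hc, hd⟩)
    · exact Or.inl rfl
    · exact Or.inr ⟨I.mul_mem _ hc, I.mul_mem _ hd⟩
    · exact Or.inr ⟨mul_comm c a ▸ I.mul_mem c ha, mul_comm c b ▸ I.mul_mem c hb⟩
    · exact Or.inr ⟨I.mul_mem _ hc, I.mul_mem _ hd⟩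

/-- The monoid quotient `M / I`: all elements of `I` are identified with `0`. -/
def MQuot {M : Type u} [CommMonoidWithZero M] (I : MIdeal M) : Type u := I.con.Quotient

instance {M : Type u} [CommMonoidWithZero M] (I : MIdeal M) : CommMonoidWithZero (MQuot I) :=
  { (inferInstance : CommMonoid I.con.Quotient) with
    zero := ((0 : M) : I.con.Quotient)
    zero_mul := fun a => Con.induction_on a fun x => by
      change ((0 * x : M) : I.con.Quotient) = ((0 : M) : I.con.Quotient)
      rw [zero_mul]
    mul_zero := fun a => Con.induction_on a fun x => by
      change ((x * 0 : M) : I.con.Quotient) = ((0 : M) : I.con.Quotient)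
      rw [mul_zero] }

/-- The quotient map `M → M / I`. -/
def MQuot.mk {M : Type u} [CommMonoidWithZero M] (I : MIdeal M) : M →*₀ MQuot I :=
  { I.con.mk' with map_zero' := rfl }

/-- A grading of a commutative monoid with zero: every element is homogeneous, and only `0` has
more than one degree. -/
structure Grading (M : Type u) [CommMonoidWithZero M] where
  piece : ℕ → Set M
  zero_mem : ∀ i, (0 : M) ∈ piece i
  one_mem : (1 : M) ∈ piece 0
  mul_mem : ∀ {i j : ℕ} {x y : M}, x ∈ piece i → y ∈ piece j → x * y ∈ piece (i + j)
  exists_mem : ∀ x : M, ∃ i, x ∈ piece i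
  eq_zero : ∀ {i j : ℕ} {x : M}, i ≠ j → x ∈ piece i → x ∈ piece j → x = 0

/-- The grading of `M / I` induced by a grading of `M`. -/
def Grading.quot {M : Type u} [CommMonoidWithZero M] (𝒜 : Grading M) (I : MIdeal M) :
    Grading (MQuot I) where
  piece i := MQuot.mk I '' 𝒜.piece i
  zero_mem i := ⟨0, 𝒜.zero_mem i, map_zero _⟩
  one_mem := ⟨1, 𝒜.one_mem, map_one _⟩
  mul_mem := by
    rintro i j _ _ ⟨x, hx, rfl⟩ ⟨y, hy, rfl⟩
    exact ⟨x * y, 𝒜.mul_mem hx hy, map_mul _ _ _⟩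
  exists_mem x := Con.induction_on x fun a => by
    obtain ⟨i, hi⟩ := 𝒜.exists_mem a
    exact ⟨i, a, hi, rfl⟩
  eq_zero := by
    rintro i j _ hij ⟨x, hx, rfl⟩ ⟨y, hy, hyx⟩
    rcases (Con.eq I.con).1 hyx with h | ⟨-, h⟩
    · subst h
      rw [𝒜.eq_zero hij hx hy, map_zero]
    · exact (Con.eq I.con).2 (Or.inr ⟨h, I.zero_mem⟩)

/-- The irrelevant ideal: `0` and all elements of positive degree. -/
def Grading.irrelevant {M : Type u} [CommMonoidWithZero M] (𝒜 : Grading M) : Set M :=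
  {0} ∪ ⋃ i ≥ 1, 𝒜.piece i

/-- Points of `Proj`: prime ideals which do not contain the irrelevant ideal. -/
structure Proj {M : Type u} [CommMonoidWithZero M] (𝒜 : Grading M) extends MIdeal M where
  one_notMem : (1 : M) ∉ carrier
  mem_or_mem : ∀ {x y : M}, x * y ∈ carrier → x ∈ carrier ∨ y ∈ carrier
  not_irrelevant_subset : ¬ 𝒜.irrelevant ⊆ carrier

section Proj

variable {M : Type u} [CommMonoidWithZero M] (𝒜 : Grading M)

/-- The set `V(s)` of points containing `s` (equivalently, the ideal generated by `s`). -/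
def zeroLocus (s : Set M) : Set (Proj 𝒜) := {p | s ⊆ p.carrier}

/-- The Zariski topology: the closed sets are the sets `V(s)`. -/
instance : TopologicalSpace (Proj 𝒜) :=
  TopologicalSpace.ofClosed (Set.range (zeroLocus 𝒜))
    ⟨{1}, Set.eq_empty_of_forall_notMem fun p hp => p.one_notMem (hp rfl)⟩
    (by
      intro A hA
      refine ⟨⋃₀ {s | zeroLocus 𝒜 s ∈ A}, Set.ext fun p => ⟨?_, ?_⟩⟩
      · intro hp Z hZ
        obtain ⟨s, rfl⟩ := hA hZ
        exact fun x hx => hp ⟨s, hZ, hx⟩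
      · rintro hp x ⟨s, hs, hx⟩
        exact hp _ hs hx)
    (by
      rintro _ ⟨s, rfl⟩ _ ⟨t, rfl⟩
      refine ⟨Set.image2 (fun x y => x * y) s t, Set.ext fun p => ⟨?_, ?_⟩⟩
      · intro hp
        by_contra h
        rw [Set.mem_union, not_or] at h
        obtain ⟨x, hx, hxp⟩ := Set.not_subset.1 h.1
        obtain ⟨y, hy, hyp⟩ := Set.not_subset.1 h.2
        exact (p.mem_or_mem (hp ⟨x, hx, y, hy, rfl⟩)).elim hxp hyp
      · rintro (hp | hp) _ ⟨x, hx, y, hy, rfl⟩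
        · change x * y ∈ p.carrier
          rw [mul_comm]
          exact p.mul_mem y (hp hx)
        · exact p.mul_mem x (hp hy))

theorem isClosed_zeroLocus (s : Set M) : IsClosed (zeroLocus 𝒜 s) :=
  ⟨s, (compl_compl _).symm⟩

/-- The open complement of `V(s)`. -/
def openLocus (s : Set M) : Opens (TopCat.of (Proj 𝒜)) :=
  ⟨(zeroLocus 𝒜 s)ᶜ, (isClosed_zeroLocus 𝒜 s).isOpen_compl⟩

variable {𝒜}

/-- The multiplicative complement of a prime ideal. -/
def Proj.primeCompl (p : Proj 𝒜) : Submonoid M where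
  carrier := p.carrierᶜ
  one_mem' := p.one_notMem
  mul_mem' hx hy hxy := (p.mem_or_mem hxy).elim hx hy

/-- The monoid `M_(p)`: fractions of elements of the same degree in the localization `M_p`. -/
def Proj.homogeneousStalk (p : Proj 𝒜) : Submonoid (Localization p.primeCompl) where
  carrier := {z | ∃ (i : ℕ) (a : M) (b : p.primeCompl),
    a ∈ 𝒜.piece i ∧ (b : M) ∈ 𝒜.piece i ∧ z = Localization.mk a b}
  one_mem' := ⟨0, 1, 1, 𝒜.one_mem, 𝒜.one_mem, Localization.mk_one.symm⟩
  mul_mem' := by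
    rintro _ _ ⟨i, a, b, ha, hb, rfl⟩ ⟨j, c, d, hc, hd, rfl⟩
    exact ⟨i + j, a * c, b * d, 𝒜.mul_mem ha hc, 𝒜.mul_mem hb hd, Localization.mk_mul _ _ _ _⟩

variable (𝒜)

/-- A family of elements of the `M_(p)`, `p ∈ U`, which is a single fraction `a / b`. -/
def isFractionPrelocal :
    TopCat.PrelocalPredicate (X := TopCat.of (Proj 𝒜)) fun p => Proj.homogeneousStalk p where
  pred {U} f := ∃ (a b : M) (hb : ∀ q : U, b ∉ q.1.carrier),
    ∀ q : U, (f q : Localization (Proj.primeCompl q.1)) = Localization.mk a ⟨b, hb q⟩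
  res := by
    rintro U V i f ⟨a, b, hb, h⟩
    exact ⟨a, b, fun q => hb ⟨q.1, i.le q.2⟩, fun q => h ⟨q.1, i.le q.2⟩⟩

/-- Families which are locally a single fraction. -/
def isLocallyFraction :
    TopCat.LocalPredicate (X := TopCat.of (Proj 𝒜)) fun p => Proj.homogeneousStalk p :=
  (isFractionPrelocal 𝒜).sheafify

/-- The monoid of sections over `U`. -/
def sections (U : (Opens (TopCat.of (Proj 𝒜)))ᵒᵖ) :
    Submonoid (∀ p : U.unop, Proj.homogeneousStalk p.1) where
  carrier := {f | (isLocallyFraction 𝒜).pred f}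
  one_mem' p := ⟨U.unop, p.2, 𝟙 _, 1, 1, fun q => q.1.one_notMem,
    fun _ => Localization.mk_one.symm⟩
  mul_mem' := by
    intro f g hf hg p
    obtain ⟨V, hV, i, a, b, hb, h⟩ := hf p
    obtain ⟨W, hW, j, c, d, hd, h'⟩ := hg p
    refine ⟨V ⊓ W, ⟨hV, hW⟩, Opens.infLELeft _ _ ≫ i, a * c, b * d, fun q hq =>
      (q.1.mem_or_mem hq).elim (hb ⟨q.1, q.2.1⟩) (hd ⟨q.1, q.2.2⟩), fun q => ?_⟩
    have h1 := h ⟨q.1, q.2.1⟩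
    have h2 := h' ⟨q.1, q.2.2⟩
    exact (congrArg₂ (· * ·) h1 h2).trans (Localization.mk_mul _ _ _ _)

/-- The structure sheaf as a sheaf of types. -/
def structureSheafInType : TopCat.Sheaf (Type u) (TopCat.of (Proj 𝒜)) :=
  TopCat.subsheafToTypes (isLocallyFraction 𝒜)

instance (U : (Opens (TopCat.of (Proj 𝒜)))ᵒᵖ) :
    CommMonoid ((structureSheafInType 𝒜).1.obj U) :=
  (sections 𝒜 U).toCommMonoid

/-- The structure presheaf as a presheaf of commutative monoids. -/
def structurePresheaf : TopCat.Presheaf CommMonCat.{u} (TopCat.of (Proj 𝒜)) where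
  obj U := CommMonCat.of ((structureSheafInType 𝒜).1.obj U)
  map i := CommMonCat.ofHom
    { toFun := (structureSheafInType 𝒜).1.map i
      map_one' := rfl
      map_mul' := fun _ _ => rfl }

/-- The structure presheaf has the sheaf of sections as underlying presheaf of types. -/
def structurePresheafCompForget :
    structurePresheaf 𝒜 ⋙ forget CommMonCat ≅ (structureSheafInType 𝒜).1 :=
  NatIso.ofComponents (fun _ => Iso.refl _) (by cat_disch)

/-- `Proj` of a graded commutative monoid with zero, as a monoidal space. -/
def projSpace : AlgebraicGeometry.SheafedSpace CommMonCat.{u} where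
  carrier := TopCat.of (Proj 𝒜)
  presheaf := structurePresheaf 𝒜
  IsSheaf := (TopCat.Presheaf.isSheaf_iff_isSheaf_comp (forget CommMonCat) _).mpr
    (TopCat.Presheaf.isSheaf_of_iso (structurePresheafCompForget 𝒜).symm
      (structureSheafInType 𝒜).property)

/-- The open subspace of `Proj` on the complement of `V(s)`. -/
def projOpen (s : Set M) : AlgebraicGeometry.SheafedSpace CommMonCat.{u} :=
  (projSpace 𝒜).restrict (openLocus 𝒜 s).isOpenEmbedding

end Proj

/-! ### Polynomials over the field with one element, and graphs in projective space -/

/-- The monoid `𝔽₁[X_i]_{i ∈ U}`: all monomials in the `X_i`, and `0`. -/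
abbrev F1Poly (U : Type u) : Type u := WithZero (Multiplicative (U →₀ ℕ))

/-- The monomial with exponents `m`. -/
def monomial {U : Type u} (m : U →₀ ℕ) : F1Poly U :=
  ((Multiplicative.ofAdd m : Multiplicative (U →₀ ℕ)) : F1Poly U)

/-- The variable `X_i`. -/
def X {U : Type u} (i : U) : F1Poly U := monomial (Finsupp.single i 1)

/-- The grading by total degree. -/
def degreeGrading (U : Type u) : Grading (F1Poly U) where
  piece i := {x | x = 0 ∨ ∃ m : U →₀ ℕ, m.degree = i ∧ x = monomial m}
  zero_mem _ := Or.inl rfl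
  one_mem := Or.inr ⟨0, map_zero _, rfl⟩
  mul_mem := by
    rintro i j _ _ (rfl | ⟨m, rfl, rfl⟩) (rfl | ⟨n, rfl, rfl⟩)
    · exact Or.inl (zero_mul _)
    · exact Or.inl (zero_mul _)
    · exact Or.inl (mul_zero _)
    · exact Or.inr ⟨m + n, map_add _ _ _, rfl⟩
  exists_mem x := by
    induction x using WithZero.recZeroCoe with
    | zero => exact ⟨0, Or.inl rfl⟩
    | coe a => exact ⟨_, Or.inr ⟨Multiplicative.toAdd a, rfl, rfl⟩⟩
  eq_zero := by
    rintro i j x hij (rfl | ⟨m, rfl, rfl⟩) (h | ⟨n, rfl, h⟩)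
    · rfl
    · rfl
    · exact h
    · exact absurd (congrArg Finsupp.degree
        (Multiplicative.ofAdd.injective (WithZero.coe_injective h))) hij

/-- The equations, in the projective space on the point set `U`, of a subgraph `Δ` of the complete
graph on `U`: the variables `X_j` of the points missing from `Δ`, and the products `X_j X_l` for the
edges missing from `Δ`. -/
def graphEqs {U : Type u} (Δ : (⊤ : SimpleGraph U).Subgraph) : Set (F1Poly U) :=
  {f | (∃ j, j ∉ Δ.verts ∧ f = X j) ∨ ∃ j l, j ≠ l ∧ ¬ Δ.Adj j l ∧ f = X j * X l}

/-- The ideal of a graph `G` on the whole point set `U`: the union of the ideals `(X_j X_l)` over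
the non-edges of `G`. -/
def graphIdeal {U : Type u} (G : SimpleGraph U) : MIdeal (F1Poly U) :=
  MIdeal.span {f | ∃ j l, j ≠ l ∧ ¬ G.Adj j l ∧ f = X j * X l}

/-- The grading by degree of the coordinate ring `𝔽₁[X_i] / ⋃ (X_j X_l)` of the graph `G`. -/
abbrev graphGrading {U : Type u} (G : SimpleGraph U) : Grading (MQuot (graphIdeal G)) :=
  (degreeGrading U).quot (graphIdeal G)

/-- The closed subscheme, of the projective space on the points of `G`, that a graph `G` defines. -/
def graphScheme {U : Type u} (G : SimpleGraph U) :
    AlgebraicGeometry.SheafedSpace CommMonCat.{u} :=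
  projSpace (graphGrading G)

/-- The open complement in projective space of the closed point set of a subgraph `Δ` of the
complete graph. -/
def complementScheme {U : Type u} (Δ : (⊤ : SimpleGraph U).Subgraph) :
    AlgebraicGeometry.SheafedSpace CommMonCat.{u} :=
  projOpen (degreeGrading U) (graphEqs Δ)

/-- The intersection of the closed subscheme of a graph `G` with the open complement of the closed
point set of a subgraph `Δ` of the complete graph. -/
def mixedScheme {U : Type u} (G : SimpleGraph U) (Δ : (⊤ : SimpleGraph U).Subgraph) :
    AlgebraicGeometry.SheafedSpace CommMonCat.{u} :=
  projOpen (graphGrading G) (MQuot.mk (graphIdeal G) '' graphEqs Δ)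

end Deitmar

/-! ### Loose graphs -/

/-- A loose graph: points `V`, edges `E` and an incidence relation, such that every edge is incident
with at most two points. -/
structure LooseGraph (V : Type u) (E : Type v) where
  Inc : V → E → Prop
  encard_le_two : ∀ e, {x | Inc x e}.encard ≤ 2

namespace LooseGraph

variable {V : Type u} {E : Type v} (Γ : LooseGraph V E)

/-- The incidence graph: points and edges are its vertices, and incident pairs are joined. -/
def incidenceGraph : SimpleGraph (V ⊕ E) where
  Adj
    | .inl x, .inr e => Γ.Inc x e
    | .inr e, .inl x => Γ.Inc x e
    | _, _ => False
  symm := ⟨by rintro (x | e) (y | f) h <;> exact h⟩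
  loopless := ⟨by rintro (x | e) h <;> exact h⟩

/-- A loose graph is connected if it is nonempty and any two of its elements (points or edges) are
joined by a chain of consecutively incident elements. -/
def Connected : Prop := Γ.incidenceGraph.Connected

/-- The points of the completion: the old ones, one new point for each edge with exactly one point,
and two new points for each edge without points. -/
inductive ComplPoint : Type (max u v)
  | old (x : V)
  | loose (e : E) (h : {x | Γ.Inc x e}.encard = 1)
  | bare (e : E) (h : {x | Γ.Inc x e} = ∅) (b : Bool)

/-- Whether a point of the completion is one of the original points. -/
def IsOld : Γ.ComplPoint → Prop
  | .old _ => True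
  | _ => False

/-- Incidence in the completion. -/
def ComplInc : Γ.ComplPoint → E → Prop
  | .old x, e => Γ.Inc x e
  | .loose e' _, e => e' = e
  | .bare e' _ _, e => e' = e

/-- The graph theoretical completion. The complete graph on the same points is the ambient
projective space of `Γ`. -/
def completion : SimpleGraph Γ.ComplPoint where
  Adj a b := a ≠ b ∧ ∃ e, Γ.ComplInc a e ∧ Γ.ComplInc b e
  symm := ⟨fun _ _ ⟨h, e, ha, hb⟩ => ⟨h.symm, e, hb, ha⟩⟩
  loopless := ⟨fun _ h => h.1 rfl⟩

/-- Type I: every edge has two points. -/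
def IsGraph : Prop := ∀ e, {x | Γ.Inc x e}.encard = 2

/-- Type II: the complement of `Γ` in its ambient complete graph, which consists of the new points
and of the edges not in `Γ`, is a graph, that is, contains both end points of each of its edges. -/
def IsComplement : Prop :=
  ∀ a b : Γ.ComplPoint, a ≠ b → ¬ Γ.completion.Adj a b → ¬ Γ.IsOld a ∧ ¬ Γ.IsOld b

/-- The graph formed by the new points and those edges between them that are not in `Γ`. For `Γ` of
type II it is the whole complement of `Γ` in the ambient complete graph. -/
def complementGraph : (⊤ : SimpleGraph Γ.ComplPoint).Subgraph where
  verts := {a | ¬ Γ.IsOld a}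
  Adj a b := a ≠ b ∧ ¬ Γ.completion.Adj a b ∧ ¬ Γ.IsOld a ∧ ¬ Γ.IsOld b
  adj_sub h := h.1
  edge_vert h := h.2.2.1
  symm := ⟨fun _ _ h => ⟨h.1.symm, fun h' => h.2.1 h'.symm, h.2.2.2, h.2.2.1⟩⟩

/-- The complete graph on the new points. -/
def newComplete : (⊤ : SimpleGraph Γ.ComplPoint).Subgraph :=
  (⊤ : (⊤ : SimpleGraph Γ.ComplPoint).Subgraph).induce {a | ¬ Γ.IsOld a}

open Classical in
/-- The loose scheme `S(Γ)`, by the type of `Γ`. -/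
def scheme : AlgebraicGeometry.SheafedSpace CommMonCat.{max u v} :=
  if Γ.IsGraph then Deitmar.graphScheme Γ.completion
  else if Γ.IsComplement then Deitmar.complementScheme Γ.complementGraph
  else Deitmar.mixedScheme Γ.completion Γ.newComplete

/-- The loose graph `C ∖ Δ` which remains when the points and edges of a subgraph `Δ` are removed
from the complete graph `C` on `W`. -/
def ofComplement {W : Type w} (Δ : (⊤ : SimpleGraph W).Subgraph) :
    LooseGraph {x : W // x ∉ Δ.verts}
      {e : Sym2 W // e ∈ (⊤ : SimpleGraph W).edgeSet ∧ e ∉ Δ.edgeSet} where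
  Inc x e := x.1 ∈ e.1
  encard_le_two := by
    rintro ⟨e, he⟩
    induction e with | _ a b =>
    refine le_trans ?_ ((Set.encard_insert_le {b} a).trans (by rw [Set.encard_singleton]; rfl))
    refine Set.encard_le_encard_of_injOn (f := Subtype.val) ?_ Subtype.val_injective.injOn
    intro x hx
    simpa using hx

end LooseGraph

end

/-! Only the underlying topological spaces matter; the structure sheaves play no role. Two
mechanisms cover all cases.

In a full projective space the ideal `{0}` is prime and specializes to every point, so an open
subset is connected exactly when it is nonempty. This handles type II and arbitrary complements
(`Deitmar.connectedSpace_complementScheme_iff`). On the combinatorial side, any two remaining points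
share a remaining edge, so the loose graph too is connected as soon as it is nonempty.

For types I and III the space is the union of the open stars {p : X_i ∉ p} of the old points i. All
points of a star specialize to the closed point of i, so stars are connected. For i ≠ j, the stars
of i and j meet if and only if i and j are adjacent: otherwise X_i X_j = 0 lies in every prime,
while a clique {i, j} defines a prime avoiding both variables. Hence the union is connected if and
only if the graph on the old points is (`Deitmar.isConnected_iUnion_star_iff`), and when every edge
has a point this is connectedness of the loose graph (`connected_iff_induce_completion`). -/

noncomputable section

namespace Deitmar

/-! ### Specialization and connectedness in `Proj` -/

section Specialization

variable {M : Type u} [CommMonoidWithZero M] {𝒜 : Grading M}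

theorem specializes_of_carrier_subset {p q : Proj 𝒜} (h : p.carrier ⊆ q.carrier) : p ⤳ q := by
  rw [specializes_iff_forall_closed]
  rintro Z ⟨s, hs⟩ hp
  obtain rfl : zeroLocus 𝒜 s = Z := by rw [hs, compl_compl]
  exact fun x hx => h (hp hx)

theorem isOpen_notMem (f : M) : IsOpen {p : Proj 𝒜 | f ∉ p.carrier} := by
  convert (isClosed_zeroLocus 𝒜 {f}).isOpen_compl using 1
  ext p
  simp [zeroLocus]

theorem isPreconnected_pair_of_specializes {α : Type*} [TopologicalSpace α] {x y : α}
    (h : x ⤳ y) : IsPreconnected {x, y} := by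
  refine isPreconnected_singleton.subset_closure (s := {x}) (by simp) ?_
  rintro z (rfl | rfl)
  · exact subset_closure rfl
  · exact h.mem_closure

theorem connectedSpace_projOpen_iff (s : Set M) :
    ConnectedSpace (projOpen 𝒜 s) ↔ IsConnected (zeroLocus 𝒜 s)ᶜ :=
  (isConnected_iff_connectedSpace (s := (zeroLocus 𝒜 s)ᶜ)).symm

end Specialization

/-! ### Monomials, and open subsets of projective space -/

section Monomials

variable {U : Type u}

theorem monomial_ne_zero (m : U →₀ ℕ) : (monomial m : F1Poly U) ≠ 0 := WithZero.coe_ne_zero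

theorem monomial_add (m n : U →₀ ℕ) : monomial (m + n) = monomial m * monomial n := rfl

theorem monomial_zero : monomial (0 : U →₀ ℕ) = 1 := rfl

theorem monomial_injective : Function.Injective (monomial : (U →₀ ℕ) → F1Poly U) :=
  fun _ _ h => Multiplicative.ofAdd.injective (WithZero.coe_injective h)

theorem eq_zero_or_monomial (f : F1Poly U) : f = 0 ∨ ∃ m, f = monomial m := by
  induction f using WithZero.recZeroCoe with
  | zero => exact Or.inl rfl
  | coe a => exact Or.inr ⟨Multiplicative.toAdd a, rfl⟩

theorem monomial_single (i : U) (n : ℕ) : monomial (Finsupp.single i n) = X i ^ n := by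
  induction n with
  | zero => rw [Finsupp.single_zero, pow_zero, monomial_zero]
  | succ n ih => rw [Finsupp.single_add, monomial_add, ih, pow_succ, X]

theorem exists_eq_mul_X {m : U →₀ ℕ} {i : U} (h : m i ≠ 0) :
    ∃ n, monomial m = monomial n * X i :=
  ⟨m - Finsupp.single i 1, by
    rw [X, ← monomial_add, tsub_add_cancel_of_le]
    rwa [Finsupp.single_le_iff, Nat.one_le_iff_ne_zero]⟩

theorem X_ne_zero (i : U) : (X i : F1Poly U) ≠ 0 := monomial_ne_zero _

/-- The generic point of a nonempty projective space. -/
def genericPoint (i : U) : Proj (degreeGrading U) where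
  carrier := {0}
  zero_mem := rfl
  mul_mem := by rintro a x rfl; exact mul_zero a
  one_notMem := one_ne_zero
  mem_or_mem := mul_eq_zero.1
  not_irrelevant_subset h := X_ne_zero i <| h <| Or.inr <| Set.mem_iUnion₂.2
    ⟨1, le_rfl, Or.inr ⟨Finsupp.single i 1, Finsupp.degree_single i 1, rfl⟩⟩

/-- The right-hand side says that `Δ` has at least one equation. Equations are nonzero monomials, so
the generic point then lies in the open set, and it is dense there. -/
theorem connectedSpace_complementScheme_iff (Δ : (⊤ : SimpleGraph U).Subgraph) :
    ConnectedSpace (complementScheme Δ) ↔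
      (∃ j, j ∉ Δ.verts) ∨ ∃ j l, j ≠ l ∧ ¬ Δ.Adj j l := by
  rw [complementScheme, connectedSpace_projOpen_iff]
  constructor
  · rintro ⟨⟨p, hp⟩, -⟩
    obtain ⟨f, ⟨j, hj, -⟩ | ⟨j, l, hjl, h, -⟩, -⟩ := Set.not_subset.1 hp
    · exact Or.inl ⟨j, hj⟩
    · exact Or.inr ⟨j, l, hjl, h⟩
  · intro h
    -- The index `i` only witnesses that `U` is nonempty, so that `{0}` does not contain the
    -- irrelevant ideal.
    obtain ⟨i, f, hf, hf0⟩ : ∃ _ : U, ∃ f ∈ graphEqs Δ, f ≠ 0 := by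
      rcases h with ⟨j, hj⟩ | ⟨j, l, hjl, h⟩
      · exact ⟨j, X j, Or.inl ⟨j, hj, rfl⟩, X_ne_zero j⟩
      · exact ⟨j, X j * X l, Or.inr ⟨j, l, hjl, h, rfl⟩,
          mul_ne_zero (X_ne_zero j) (X_ne_zero l)⟩
    have hmem : genericPoint i ∈ (zeroLocus (degreeGrading U) (graphEqs Δ))ᶜ :=
      fun h => hf0 (h hf)
    refine ⟨⟨_, hmem⟩, isPreconnected_singleton.subset_closure
      (Set.singleton_subset_iff.2 hmem) fun p _ => ?_⟩
    refine (specializes_of_carrier_subset ?_).mem_closure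
    rintro _ rfl
    exact p.zero_mem

end Monomials

/-! ### Primes of the coordinate ring of a graph, cliques and open stars -/

section Cliques

variable {U : Type u} {G : SimpleGraph U}

/-- The class of the variable `X_i` in the coordinate ring of a graph. -/
def graphVar (G : SimpleGraph U) (i : U) : MQuot (graphIdeal G) := MQuot.mk (graphIdeal G) (X i)

theorem adj_of_graphVar_notMem {p : Proj (graphGrading G)} {i j : U} (hij : i ≠ j)
    (hi : graphVar G i ∉ p.carrier) (hj : graphVar G j ∉ p.carrier) : G.Adj i j := by
  by_contra h
  refine (p.mem_or_mem (x := graphVar G i) (y := graphVar G j) ?_).elim hi hj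
  have h0 : graphVar G i * graphVar G j = 0 := by
    rw [graphVar, graphVar, ← map_mul]
    exact (Con.eq _).2 (Or.inr ⟨Or.inr ⟨_, ⟨i, j, hij, h, rfl⟩, dvd_rfl⟩, Or.inl rfl⟩)
  rw [h0]
  exact p.zero_mem

/-- Every monomial of positive degree is a multiple of a variable, so a prime with all variables
would contain the irrelevant ideal. -/
theorem exists_graphVar_notMem (p : Proj (graphGrading G)) : ∃ i, graphVar G i ∉ p.carrier := by
  by_contra! h
  refine p.not_irrelevant_subset ?_
  rintro z (rfl | hz)
  · exact p.zero_mem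
  obtain ⟨d, hd, f, rfl | ⟨m, rfl, rfl⟩, rfl⟩ := Set.mem_iUnion₂.1 hz
  · rw [map_zero]
    exact p.zero_mem
  obtain ⟨i, hi⟩ : ∃ i, m i ≠ 0 := by
    by_contra! h0
    obtain rfl : m = 0 := Finsupp.ext h0
    simp at hd
  obtain ⟨n, hn⟩ := exists_eq_mul_X hi
  rw [hn, map_mul]
  exact p.mul_mem _ (h i)

/-- The monomials that involve a variable outside of `S`, and `0`. -/
def outside (S : Set U) : Set (F1Poly U) :=
  {f | f = 0 ∨ ∃ m : U →₀ ℕ, f = monomial m ∧ ∃ i ∉ S, m i ≠ 0}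

theorem monomial_mem_outside {S : Set U} {m : U →₀ ℕ} :
    monomial m ∈ outside S ↔ ∃ i ∉ S, m i ≠ 0 := by
  constructor
  · rintro (h | ⟨n, h, hn⟩)
    · exact absurd h (monomial_ne_zero m)
    · rwa [monomial_injective h]
  · exact fun h => Or.inr ⟨m, rfl, h⟩

theorem mul_mem_outside {S : Set U} (f : F1Poly U) {g : F1Poly U} (hg : g ∈ outside S) :
    f * g ∈ outside S := by
  obtain rfl | ⟨n, rfl, i, hi, hn⟩ := hg
  · exact Or.inl (mul_zero f)
  obtain rfl | ⟨m, rfl⟩ := eq_zero_or_monomial f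
  · exact Or.inl (zero_mul _)
  · exact Or.inr ⟨m + n, rfl, i, hi, by simp [hn]⟩

theorem mem_or_mem_of_mul_mem_outside {S : Set U} {f g : F1Poly U} (h : f * g ∈ outside S) :
    f ∈ outside S ∨ g ∈ outside S := by
  obtain rfl | ⟨m, rfl⟩ := eq_zero_or_monomial f
  · exact Or.inl (Or.inl rfl)
  obtain rfl | ⟨n, rfl⟩ := eq_zero_or_monomial g
  · exact Or.inr (Or.inl rfl)
  rw [← monomial_add, monomial_mem_outside] at h
  obtain ⟨i, hi, hmn⟩ := h
  rw [monomial_mem_outside, monomial_mem_outside]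
  by_cases hm : m i = 0
  · exact Or.inr ⟨i, hi, by simpa [hm] using hmn⟩
  · exact Or.inl ⟨i, hi, hm⟩

theorem X_mem_outside {S : Set U} {i : U} : X i ∈ outside S ↔ i ∉ S := by
  rw [X, monomial_mem_outside]
  constructor
  · rintro ⟨j, hj, h⟩
    obtain rfl : i = j := by
      by_contra hij
      exact h (Finsupp.single_eq_of_ne (Ne.symm hij))
    exact hj
  · exact fun h => ⟨i, h, by simp⟩

/-- A non-edge cannot have both ends in a clique, so each generator involves a variable outside `S`.
-/
theorem graphIdeal_subset_outside {S : Set U} (hS : G.IsClique S) :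
    (graphIdeal G).carrier ⊆ outside S := by
  rintro f (rfl | ⟨_, ⟨j, l, hjl, h, rfl⟩, g, rfl⟩)
  · exact Or.inl rfl
  rw [mul_comm]
  refine mul_mem_outside _ ?_
  by_cases hj : j ∈ S
  · exact mul_mem_outside _ (X_mem_outside.2 fun hl => h (hS hj hl hjl))
  · rw [mul_comm]
    exact mul_mem_outside _ (X_mem_outside.2 hj)

/-- The congruence identifies only elements of the graph ideal, all of which lie in `outside S`;
hence that set is saturated and its primality descends to the quotient. -/
theorem mk_mem_image_outside {S : Set U} (hS : G.IsClique S) {f : F1Poly U} :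
    MQuot.mk (graphIdeal G) f ∈ MQuot.mk (graphIdeal G) '' outside S ↔ f ∈ outside S := by
  refine ⟨?_, fun h => ⟨f, h, rfl⟩⟩
  rintro ⟨g, hg, hgf⟩
  rcases (Con.eq (graphIdeal G).con).1 hgf with h | ⟨-, h⟩
  · exact h ▸ hg
  · exact graphIdeal_subset_outside hS h

/-- The point of the closed subscheme of a graph that belongs to a nonempty clique. -/
def cliquePoint {S : Set U} (hS : G.IsClique S) (hne : S.Nonempty) : Proj (graphGrading G) where
  carrier := MQuot.mk (graphIdeal G) '' outside S
  zero_mem := ⟨0, Or.inl rfl, map_zero _⟩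
  mul_mem := by
    rintro a _ ⟨g, hg, rfl⟩
    obtain ⟨f, rfl⟩ := Con.mk'_surjective (c := (graphIdeal G).con) a
    exact ⟨f * g, mul_mem_outside f hg, map_mul _ _ _⟩
  one_notMem := by
    rw [← map_one (MQuot.mk (graphIdeal G)), mk_mem_image_outside hS, ← monomial_zero,
      monomial_mem_outside]
    simp
  mem_or_mem := by
    intro x y h
    obtain ⟨f, rfl⟩ := Con.mk'_surjective (c := (graphIdeal G).con) x
    obtain ⟨g, rfl⟩ := Con.mk'_surjective (c := (graphIdeal G).con) y
    exact (mem_or_mem_of_mul_mem_outside ((mk_mem_image_outside hS (f := f * g)).1 h)).imp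
      (mk_mem_image_outside hS).2 (mk_mem_image_outside hS).2
  not_irrelevant_subset h := by
    obtain ⟨i, hi⟩ := hne
    refine X_mem_outside.1 ((mk_mem_image_outside hS (f := X i)).1 (h (Or.inr ?_))) hi
    exact Set.mem_iUnion₂.2
      ⟨1, le_rfl, _, Or.inr ⟨Finsupp.single i 1, Finsupp.degree_single i 1, rfl⟩, rfl⟩

theorem graphVar_notMem_cliquePoint {S : Set U} (hS : G.IsClique S) (hne : S.Nonempty) {i : U}
    (hi : i ∈ S) : graphVar G i ∉ (cliquePoint hS hne).carrier := fun h =>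
  X_mem_outside.1 ((mk_mem_image_outside hS).1 h) hi

/-- The open star of the closed point of a vertex. -/
def star (G : SimpleGraph U) (i : U) : Set (Proj (graphGrading G)) :=
  {p | graphVar G i ∉ p.carrier}

/-- A prime without X_i contains no power of X_i, so each of its elements is zero or involves
another variable. -/
theorem specializes_cliquePoint_singleton {i : U} {p : Proj (graphGrading G)} (hp : p ∈ star G i) :
    p ⤳ cliquePoint (G := G) (S := {i}) (Set.pairwise_singleton _ _) ⟨i, rfl⟩ := by
  refine specializes_of_carrier_subset fun z hz => ?_
  obtain ⟨f, rfl⟩ := Con.mk'_surjective (c := (graphIdeal G).con) z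
  refine ⟨f, ?_, rfl⟩
  obtain rfl | ⟨m, rfl⟩ := eq_zero_or_monomial f
  · exact Or.inl rfl
  rw [monomial_mem_outside]
  by_contra! h
  have hm : m = Finsupp.single i (m i) := by
    ext j
    by_cases hj : j = i
    · subst hj
      simp
    · rw [Finsupp.single_eq_of_ne hj]
      exact h j hj
  rw [hm, monomial_single] at hz
  exact p.primeCompl.pow_mem (x := graphVar G i) hp (m i) hz

theorem star_nonempty (i : U) : (star G i).Nonempty :=
  ⟨_, graphVar_notMem_cliquePoint (G := G) (S := {i}) (Set.pairwise_singleton _ _) ⟨i, rfl⟩ rfl⟩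

theorem isPreconnected_star (i : U) : IsPreconnected (star G i) := by
  have hmem : cliquePoint (G := G) (S := {i}) (Set.pairwise_singleton _ _) ⟨i, rfl⟩ ∈ star G i :=
    graphVar_notMem_cliquePoint _ _ rfl
  refine isPreconnected_of_forall _ fun p hp => ⟨_, ?_, Or.inr rfl, Or.inl rfl,
    isPreconnected_pair_of_specializes (specializes_cliquePoint_singleton hp)⟩
  rintro q (rfl | rfl)
  · exact hp
  · exact hmem

theorem star_inter_star_nonempty {i j : U} (h : G.Adj i j) :
    (star G i ∩ star G j).Nonempty := by
  have hS : G.IsClique {i, j} := by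
    rw [SimpleGraph.isClique_pair]
    exact fun _ => h
  exact ⟨cliquePoint hS ⟨i, Or.inl rfl⟩, graphVar_notMem_cliquePoint _ _ (Or.inl rfl),
    graphVar_notMem_cliquePoint _ _ (Or.inr rfl)⟩

/-- A union of open stars is connected if and only if the graph on their centers is. -/
theorem isConnected_iUnion_star_iff (O : Set U) :
    IsConnected (⋃ i : O, star G i) ↔ (G.induce O).Connected := by
  rw [SimpleGraph.connected_iff]
  constructor
  · rintro ⟨⟨p, hp⟩, hpre⟩
    obtain ⟨i₀, -⟩ := Set.mem_iUnion.1 hp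
    refine ⟨fun i j => ?_, ⟨i₀⟩⟩
    by_contra hij
    -- Separate the stars whose center is reachable from `i` from the others. A common point `q`
    -- would lie in the stars of two distinct, hence adjacent, centers from different classes.
    obtain ⟨q, -, hqA, hqB⟩ := hpre (⋃ k : {k : O // (G.induce O).Reachable i k}, star G k.1)
      (⋃ k : {k : O // ¬ (G.induce O).Reachable i k}, star G k.1)
      (isOpen_iUnion fun _ => isOpen_notMem _) (isOpen_iUnion fun _ => isOpen_notMem _)
      (fun q hq => by
        obtain ⟨k, hk⟩ := Set.mem_iUnion.1 hq
        by_cases h : (G.induce O).Reachable i k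
        · exact Or.inl (Set.mem_iUnion.2 ⟨⟨k, h⟩, hk⟩)
        · exact Or.inr (Set.mem_iUnion.2 ⟨⟨k, h⟩, hk⟩))
      (by
        obtain ⟨q, hq⟩ := star_nonempty (G := G) i
        exact ⟨q, Set.mem_iUnion.2 ⟨i, hq⟩, Set.mem_iUnion.2 ⟨⟨i, .refl _⟩, hq⟩⟩)
      (by
        obtain ⟨q, hq⟩ := star_nonempty (G := G) j
        exact ⟨q, Set.mem_iUnion.2 ⟨j, hq⟩, Set.mem_iUnion.2 ⟨⟨j, hij⟩, hq⟩⟩)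
    obtain ⟨⟨k, hk⟩, hqk⟩ := Set.mem_iUnion.1 hqA
    obtain ⟨⟨l, hl⟩, hql⟩ := Set.mem_iUnion.1 hqB
    have hkl : (k : U) ≠ l := fun h => hl (Subtype.ext h ▸ hk)
    have hadj : G.Adj k l := adj_of_graphVar_notMem hkl hqk hql
    exact hl (hk.trans (SimpleGraph.Adj.reachable (G := G.induce O) hadj))
  · rintro ⟨hpre, ⟨i⟩⟩
    refine ⟨?_, IsPreconnected.iUnion_of_reflTransGen (fun i => isPreconnected_star i.1) ?_⟩
    · obtain ⟨q, hq⟩ := star_nonempty (G := G) i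
      exact ⟨q, Set.mem_iUnion.2 ⟨i, hq⟩⟩
    · intro i j
      exact Relation.ReflTransGen.mono (fun a b hab => star_inter_star_nonempty hab) i j
        ((SimpleGraph.reachable_iff_reflTransGen i j).1 (hpre i j))

end Cliques

end Deitmar

/-- Weaker than a graph homomorphism: an edge may collapse or become a longer path, as happens when
passing between incidence graphs and adjacency graphs. -/
theorem SimpleGraph.Reachable.of_forall_adj {α : Type*} {β : Type*} {G : SimpleGraph α}
    {H : SimpleGraph β} (f : α → β) (hf : ∀ a b, G.Adj a b → H.Reachable (f a) (f b)) {a b : α}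
    (h : G.Reachable a b) : H.Reachable (f a) (f b) := by
  obtain ⟨w⟩ := h
  induction w with
  | nil => exact .refl _
  | cons hadj _ ih => exact (hf _ _ hadj).trans ih

/-! ### Connectedness of loose graphs and the three types -/

namespace LooseGraph

variable {V : Type u} {E : Type v} {Γ : LooseGraph V E}

theorem reachable_of_inc {x : V} {e : E} (h : Γ.Inc x e) :
    Γ.incidenceGraph.Reachable (.inl x) (.inr e) :=
  SimpleGraph.Adj.reachable (G := Γ.incidenceGraph) (u := Sum.inl x) (v := Sum.inr e) h

/-- If every edge has a point, connectedness can be tested on the graph of old points. -/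
theorem connected_iff_induce_completion (hΓ : ∀ e, ∃ x, Γ.Inc x e) :
    Γ.Connected ↔ (Γ.completion.induce {a | Γ.IsOld a}).Connected := by
  choose f hf using hΓ
  let o : V → {a | Γ.IsOld a} := fun x => ⟨.old x, trivial⟩
  have hshare {x y : V} {e : E} (hx : Γ.Inc x e) (hy : Γ.Inc y e) :
      (Γ.completion.induce {a | Γ.IsOld a}).Reachable (o x) (o y) := by
    by_cases hxy : x = y
    · rw [hxy]
    · refine SimpleGraph.Adj.reachable ?_
      exact ⟨fun h => hxy (ComplPoint.old.inj h), e, hx, hy⟩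
  rw [Connected, SimpleGraph.connected_iff, SimpleGraph.connected_iff]
  constructor
  · rintro ⟨hpre, ⟨z⟩⟩
    refine ⟨?_, ⟨o (Sum.elim id f z)⟩⟩
    rintro ⟨x | _ | _, hx⟩ ⟨y | _ | _, hy⟩
    -- Retract the incidence graph onto the points by sending each edge to its chosen point; an
    -- incident pair goes to two points of one edge.
    · refine (hpre (.inl x) (.inl y)).of_forall_adj (fun z => o (Sum.elim id f z)) ?_
      rintro (a | e) (b | e') h
      · exact h.elim
      · exact hshare h (hf _)
      · exact hshare (hf _) h
      · exact h.elim
    all_goals first | exact hx.elim | exact hy.elim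
  · rintro ⟨hpre, ⟨a⟩⟩
    have hold (x y : V) : Γ.incidenceGraph.Reachable (.inl x) (.inl y) := by
      let g : {a | Γ.IsOld a} → V ⊕ E := fun a => match a with
        | ⟨.old x, _⟩ => .inl x
      refine (hpre (o x) (o y)).of_forall_adj g ?_
      rintro ⟨x | _ | _, hx⟩ ⟨y | _ | _, hy⟩ ⟨-, e, hxe, hye⟩
      · exact (reachable_of_inc hxe).trans (reachable_of_inc hye).symm
      all_goals first | exact hx.elim | exact hy.elim
    refine ⟨?_, ?_⟩
    · rintro (x | e) (y | e')
      · exact hold x y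
      · exact (hold x (f e')).trans (reachable_of_inc (hf e'))
      · exact (reachable_of_inc (hf e)).symm.trans (hold (f e) y)
      · exact (reachable_of_inc (hf e)).symm.trans
          ((hold (f e) (f e')).trans (reachable_of_inc (hf e')))
    · obtain ⟨x | _ | _, hx⟩ := a
      · exact ⟨.inl x⟩
      all_goals exact hx.elim

theorem connected_of_forall_inc (hΓ : ∀ e, ∃ x, Γ.Inc x e) (hV : Nonempty V)
    (h : ∀ x y, x ≠ y → ∃ e, Γ.Inc x e ∧ Γ.Inc y e) : Γ.Connected := by
  rw [connected_iff_induce_completion hΓ, SimpleGraph.connected_iff]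
  refine ⟨?_, hV.map fun x => ⟨.old x, trivial⟩⟩
  rintro ⟨x | _ | _, hx⟩ ⟨y | _ | _, hy⟩
  · by_cases hxy : x = y
    · subst hxy
      exact .refl _
    · refine SimpleGraph.Adj.reachable ?_
      exact ⟨fun h => hxy (ComplPoint.old.inj h), h x y hxy⟩
  all_goals first | exact hx.elim | exact hy.elim

theorem connected_of_isEmpty [IsEmpty V] [Subsingleton E] (e : E) : Γ.Connected := by
  rw [Connected, SimpleGraph.connected_iff]
  refine ⟨?_, ⟨.inr e⟩⟩
  rintro (x | a) (y | b)
  · exact isEmptyElim x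
  · exact isEmptyElim x
  · exact isEmptyElim y
  · rw [Subsingleton.elim a b]

theorem isOld_of_isGraph (h : Γ.IsGraph) (a : Γ.ComplPoint) : Γ.IsOld a := by
  rcases a with x | ⟨e, he⟩ | ⟨e, he, b⟩
  · trivial
  · exact absurd ((h e).symm.trans he) (by norm_num)
  · have := h e
    rw [he, Set.encard_empty] at this
    exact absurd this (by norm_num)

theorem connectedSpace_graphScheme_iff (h : Γ.IsGraph) :
    ConnectedSpace (Deitmar.graphScheme Γ.completion) ↔ Γ.Connected := by
  have hΓ (e : E) : ∃ x, Γ.Inc x e := by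
    by_contra! h0
    have : {x | Γ.Inc x e} = ∅ := Set.eq_empty_of_forall_notMem h0
    have h2 := h e
    rw [this, Set.encard_empty] at h2
    exact absurd h2 (by norm_num)
  rw [connected_iff_induce_completion hΓ, ← Deitmar.isConnected_iUnion_star_iff]
  refine connectedSpace_iff_univ.trans (Eq.to_iff (congrArg IsConnected ?_))
  refine (Set.eq_univ_of_forall fun p => ?_).symm
  obtain ⟨i, hi⟩ := Deitmar.exists_graphVar_notMem p
  exact Set.mem_iUnion.2 ⟨⟨i, isOld_of_isGraph h i⟩, hi⟩

/-- Each equation of the complete graph on the new points involves an old variable, and each old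
variable is itself an equation; so the open set is the union of the stars of the old points. -/
theorem connectedSpace_mixedScheme_iff (hΓ : ∀ e, ∃ x, Γ.Inc x e) :
    ConnectedSpace (Deitmar.mixedScheme Γ.completion Γ.newComplete) ↔ Γ.Connected := by
  rw [connected_iff_induce_completion hΓ, ← Deitmar.isConnected_iUnion_star_iff,
    Deitmar.mixedScheme, Deitmar.connectedSpace_projOpen_iff]
  refine Eq.to_iff (congrArg IsConnected (Set.ext fun p => ⟨fun hp => ?_, fun hp => ?_⟩))
  · obtain ⟨_, ⟨f, hf, rfl⟩, hfp⟩ := Set.not_subset.1 hp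
    have hverts {j} : j ∉ Γ.newComplete.verts → Γ.IsOld j := not_not.1
    obtain ⟨j, hj, rfl⟩ | ⟨j, l, hjl, h, rfl⟩ := hf
    · exact Set.mem_iUnion.2 ⟨⟨j, hverts hj⟩, hfp⟩
    · rw [map_mul] at hfp
      by_cases hj : Γ.IsOld j
      · refine Set.mem_iUnion.2 ⟨⟨j, hj⟩, fun h' => hfp ?_⟩
        rw [mul_comm]
        exact p.mul_mem _ h'
      by_cases hl : Γ.IsOld l
      · exact Set.mem_iUnion.2 ⟨⟨l, hl⟩, fun h' => hfp (p.mul_mem _ h')⟩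
      · exact absurd ⟨hj, hl, hjl⟩ h
  · obtain ⟨⟨j, hj⟩, hjp⟩ := Set.mem_iUnion.1 hp
    exact fun h => hjp (h ⟨_, Or.inl ⟨j, not_not.2 hj, rfl⟩, rfl⟩)

/-- Both sides always hold. Type II forces any two old points to share an edge; without old points,
only a single bare edge is left. -/
theorem connectedSpace_complementScheme_iff (hg : ¬ Γ.IsGraph) (hc : Γ.IsComplement)
    (hΓ : ∀ e : E, (∃ x : V, Γ.Inc x e) ∨ (IsEmpty V ∧ Subsingleton E)) :
    ConnectedSpace (Deitmar.complementScheme Γ.complementGraph) ↔ Γ.Connected := by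
  rw [Deitmar.connectedSpace_complementScheme_iff]
  -- The empty loose graph is vacuously of type I, so failing type I supplies an edge.
  obtain ⟨e, -⟩ := not_forall.1 hg
  by_cases hV : IsEmpty V
  · obtain ⟨x, -⟩ | ⟨-, hE⟩ := hΓ e
    · exact isEmptyElim x
    · have h0 : {x | Γ.Inc x e} = ∅ := Set.eq_empty_of_isEmpty _
      refine iff_of_true (Or.inr ⟨.bare e h0 true, .bare e h0 false, by simp, ?_⟩)
        (connected_of_isEmpty e)
      exact fun h => h.2.1 ⟨h.1, e, rfl, rfl⟩
  · rw [not_isEmpty_iff] at hV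
    refine iff_of_true (Or.inl (hV.elim fun x => ⟨.old x, not_not.2 trivial⟩)) ?_
    refine connected_of_forall_inc
      (fun e => (hΓ e).resolve_right fun h => not_isEmpty_iff.2 hV h.1) hV fun x y hxy => ?_
    by_contra h
    exact (hc (.old x) (.old y) (fun h => hxy (ComplPoint.old.inj h)) fun h' => h h'.2).1 trivial

theorem connectedSpace_scheme_iff
    (hΓ : ∀ e : E, (∃ x : V, Γ.Inc x e) ∨ (IsEmpty V ∧ Subsingleton E)) :
    ConnectedSpace Γ.scheme ↔ Γ.Connected := by
  by_cases hg : Γ.IsGraph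
  · rw [show Γ.scheme = _ from if_pos hg]
    exact connectedSpace_graphScheme_iff hg
  by_cases hc : Γ.IsComplement
  · rw [show Γ.scheme = _ from (if_neg hg).trans (if_pos hc)]
    exact connectedSpace_complementScheme_iff hg hc hΓ
  · rw [show Γ.scheme = _ from (if_neg hg).trans (if_neg hc)]
    refine connectedSpace_mixedScheme_iff fun e => (hΓ e).resolve_right ?_
    rintro ⟨hV, hE⟩
    -- Without old points and with a single edge, all points of the completion lie on that edge, so
    -- no pair is non-adjacent and the type is II.
    refine hc fun a b hab hadj => absurd ?_ hadj
    refine ⟨hab, e, ?_, ?_⟩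
    · rcases a with x | _ | _
      exacts [isEmptyElim x, Subsingleton.elim _ _, Subsingleton.elim _ _]
    · rcases b with x | _ | _
      exacts [isEmptyElim x, Subsingleton.elim _ _, Subsingleton.elim _ _]

/-- Both sides amount to some point or edge being left after removing `Δ`. -/
theorem connectedSpace_complementScheme_iff_ofComplement {W : Type w}
    (Δ : (⊤ : SimpleGraph W).Subgraph)
    (hΔ : ∀ e, (∃ x, (ofComplement Δ).Inc x e) ∨ (IsEmpty {x : W // x ∉ Δ.verts} ∧
      Subsingleton {e : Sym2 W // e ∈ (⊤ : SimpleGraph W).edgeSet ∧ e ∉ Δ.edgeSet})) :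
    ConnectedSpace (Deitmar.complementScheme Δ) ↔ (ofComplement Δ).Connected := by
  rw [Deitmar.connectedSpace_complementScheme_iff]
  have hedge {j l : W} (hjl : j ≠ l) (h : ¬ Δ.Adj j l) :
      s(j, l) ∈ (⊤ : SimpleGraph W).edgeSet ∧ s(j, l) ∉ Δ.edgeSet := ⟨hjl, h⟩
  constructor
  · intro h
    by_cases hV : IsEmpty {x : W // x ∉ Δ.verts}
    · obtain ⟨j, hj⟩ | ⟨j, l, hjl, hadj⟩ := h
      · exact (hV.false ⟨j, hj⟩).elim
      · obtain ⟨x, -⟩ | ⟨-, hE⟩ := hΔ ⟨_, hedge hjl hadj⟩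
        · exact (hV.false x).elim
        · exact connected_of_isEmpty ⟨_, hedge hjl hadj⟩
    · refine connected_of_forall_inc (fun e => (hΔ e).resolve_right fun h => hV h.1)
        (not_isEmpty_iff.1 hV) fun x y hxy => ?_
      -- An edge of `Δ` has its ends in `Δ`, so the edge joining two remaining points also remains.
      refine ⟨⟨s(x.1, y.1), hedge (fun h => hxy (Subtype.ext h)) fun h => x.2 h.fst_mem⟩, ?_, ?_⟩
      · exact Sym2.mem_mk_left _ _
      · exact Sym2.mem_mk_right _ _
  · rintro h
    obtain ⟨x | ⟨e, he⟩⟩ := ((SimpleGraph.connected_iff _).1 h).2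
    · exact Or.inl ⟨x.1, x.2⟩
    · induction e with | _ j l =>
      exact Or.inr ⟨j, l, he.1, he.2⟩

end LooseGraph

end

theorem mainTheorem11 :
    (∀ {V : Type u} {E : Type v} (Γ : LooseGraph V E),
      (∀ e : E, (∃ x : V, Γ.Inc x e) ∨ (IsEmpty V ∧ Subsingleton E)) →
        (ConnectedSpace Γ.scheme ↔ Γ.Connected)) ∧
    (∀ {W : Type w} (Δ : (⊤ : SimpleGraph W).Subgraph),
      (∀ e, (∃ x, (LooseGraph.ofComplement Δ).Inc x e) ∨
        (IsEmpty {x : W // x ∉ Δ.verts} ∧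
          Subsingleton {e : Sym2 W // e ∈ (⊤ : SimpleGraph W).edgeSet ∧ e ∉ Δ.edgeSet})) →
        (ConnectedSpace (Deitmar.complementScheme Δ) ↔
          (LooseGraph.ofComplement Δ).Connected)) :=
  ⟨fun _ hΓ => LooseGraph.connectedSpace_scheme_iff hΓ,
    fun Δ hΔ => LooseGraph.connectedSpace_complementScheme_iff_ofComplement Δ hΔ⟩
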